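/- Let $a,b$ be integers with $2\le a<b$, and let $\mathfrak F_{a,b}$ be the tree containing a vertex $o$ with $a+1$ neighbours $g_0,\dots,g_a$ such that $g_0$ and every vertex whose geodesic from $o$ passes through $g_0$ have valence $b+1$, while every vertex whose geodesic from $o$ passes through one of $g_1,\dots,g_a$ (these neighbours included) has valence $a+1$. Equip $\mathfrak F_{a,b}$ with its graph distance $d$ and its set of vertices with the counting measure, write $|E|$ for the number of elements of $E$, and let $B_r(x)=\{y: d(x,y)\le r\}$ for a vertex $x$ and $r\in\mathbb N=\{0,1,2,\dots\}$. For a complex-valued function $f$ on the vertices define the centred and uncentred Hardy--Littlewood maximal functions $$\mathcal M f(x)=\sup_{r\in\mathbb N}\frac1{|B_r(x)|}\sum_{y\in B_r(x)}|f(y)|,\qquad \mathcal N f(x)=\sup_{B\ni x}\frac1{|B|}\sum_{y\in B}|f(y)|,$$ where the second supremum is over all balls $B=B_r(z)$ ($z$ a vertex, $r\in\mathbb N$) that contain $x$. Then: (i) $\mathcal N$ is unbounded on $L^p(\mathfrak F_{a,b})$ for every $p\in[1,\infty)$, i.e. there is no constant $C<\infty$ with $\|\mathcal N f\|_p\le C\|f\|_p$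 for all $f\in L^p(\mathfrak F_{a,b})$; (ii) $\mathcal M$ is bounded on $L^p(\mathfrak F_{a,b})$ for every $p\in(1,\infty)$, and it is of weak type $(1,1)$, i.e. there is a constant $C<\infty$ such that $\lambda\,|\{x:\mathcal M f(x)>\lambda\}|\le C\|f\|_1$ for all $f\in L^1(\mathfrak F_{a,b})$ and all $\lambda>0$. -/

import Mathlib

open MeasureTheory
open scoped ENNReal NNReal

section GraphMaximal

variable {V : Type*}

/-- The closed ball `B_r(x)` for the graph distance. -/
def SimpleGraph.distClosedBall (G : SimpleGraph V) (x : V) (r : ℕ) : Set V :=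
  {y | G.dist x y ≤ r}

variable [MeasurableSpace V]

/-- The average of `|f|` over `B_r(x)` with respect to the counting measure. -/
noncomputable def ballAverage (G : SimpleGraph V) (f : V → ℂ) (x : V) (r : ℕ) : ℝ≥0∞ :=
  (∫⁻ y in G.distClosedBall x r, ‖f y‖ₑ ∂Measure.count) / Measure.count (G.distClosedBall x r)

/-- The centred Hardy--Littlewood maximal function. -/
noncomputable def centredMaximal (G : SimpleGraph V) (f : V → ℂ) (x : V) : ℝ≥0∞ :=
  ⨆ r : ℕ, ballAverage G f x r

/-- The uncentred Hardy--Littlewood maximal function: the supremum is over all balls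
`B_r(z)` that contain `x`. -/
noncomputable def uncentredMaximal (G : SimpleGraph V) (f : V → ℂ) (x : V) : ℝ≥0∞ :=
  ⨆ (z : V) (r : ℕ) (_ : x ∈ G.distClosedBall z r), ballAverage G f z r

/-- The operator `T` is bounded on `L^p` of the counting measure. -/
def BoundedOnLp (T : (V → ℂ) → V → ℝ≥0∞) (p : ℝ≥0∞) : Prop :=
  ∃ C : ℝ≥0, ∀ f : V → ℂ, MemLp f p Measure.count →
    eLpNorm (T f) p Measure.count ≤ C * eLpNorm f p Measure.count

/-- The operator `T` is of weak type `(1,1)` for the counting measure. -/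
def WeakTypeOneOne (T : (V → ℂ) → V → ℝ≥0∞) : Prop :=
  ∃ C : ℝ≥0, ∀ f : V → ℂ, MemLp f 1 Measure.count → ∀ l : ℝ≥0, 0 < l →
    (l : ℝ≥0∞) * Measure.count {x | (l : ℝ≥0∞) < T f x} ≤ C * eLpNorm f 1 Measure.count

end GraphMaximal

namespace GluedTree

/-- A vertex is coded by the word that describes the geodesic from the root `o = []` to it, the
last step being the head of the list; the neighbours of the root are `[0], …, [a]`. The number of
neighbours of a vertex that are farther from the root is `a + 1` at the root, `b` at the vertices
whose geodesic from the root starts with the step to `[0]`, and `a` at all others. -/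
def numChildren (a b : ℕ) (w : List ℕ) : ℕ :=
  if w = [] then a + 1 else if w.getLast? = some 0 then b else a

/-- The words that code a vertex. -/
def IsVertex (a b : ℕ) : List ℕ → Prop
  | [] => True
  | c :: w => c < numChildren a b w ∧ IsVertex a b w

/-- The vertices of the tree `F_{a,b}`. -/
@[ext]
structure Vertex (a b : ℕ) where
  /-- The word that codes the vertex. -/
  word : List ℕ
  isVertex : IsVertex a b word

instance (a b : ℕ) : MeasurableSpace (Vertex a b) := ⊤

instance (a b : ℕ) : DiscreteMeasurableSpace (Vertex a b) := ⟨fun _ => trivial⟩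

/-- The tree `F_{a,b}`: the edges join each vertex to its children. -/
def graph (a b : ℕ) : SimpleGraph (Vertex a b) where
  Adj x y := (∃ c, y.word = c :: x.word) ∨ (∃ c, x.word = c :: y.word)
  symm := ⟨fun _ _ h => h.symm⟩
  loopless := ⟨fun x h => by rcases h with ⟨c, h⟩ | ⟨c, h⟩ <;> simpa using congrArg List.length h⟩

theorem connected_graph (a b : ℕ) : (graph a b).Connected := by
  have key : ∀ (w : List ℕ) (h : IsVertex a b w),
      (graph a b).Reachable ⟨[], trivial⟩ ⟨w, h⟩ := by
    intro w
    induction w with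
    | nil => intro h; exact SimpleGraph.Reachable.refl _
    | cons c w ih =>
      intro h
      refine (ih h.2).trans (SimpleGraph.Adj.reachable ?_)
      exact Or.inl ⟨c, rfl⟩
  have : Nonempty (Vertex a b) := ⟨⟨[], trivial⟩⟩
  exact ⟨fun x y => (key x.word x.isVertex).symm.trans (key y.word y.isVertex)⟩

theorem isTree_graph (a b : ℕ) : (graph a b).IsTree := by
  refine ⟨connected_graph a b, ?_⟩
  rw [SimpleGraph.isAcyclic_iff_forall_adj_isBridge]
  have key : ∀ x y : Vertex a b, (∃ c, y.word = c :: x.word) → (graph a b).IsBridge s(x, y) := by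
    rintro x y ⟨c, hc⟩
    rw [SimpleGraph.isBridge_iff]
    have inv : ∀ u v : Vertex a b, ((graph a b) \ SimpleGraph.fromEdgeSet {s(x, y)}).Walk u v →
        y.word <:+ v.word → y.word <:+ u.word := by
      intro u v p
      induction p with
      | nil => exact id
      | @cons u v w h p ih =>
        intro hw
        have hv := ih hw
        rw [SimpleGraph.sdiff_adj] at h
        obtain ⟨⟨d, hd⟩ | ⟨d, hd⟩, hn⟩ := h
        · rw [hd, List.suffix_cons_iff] at hv
          rcases hv with hv | hv
          · exfalso
            rw [hc] at hv
            have h1 : v = y := Vertex.ext (by rw [hd, hc, hv])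
            have h2 : u = x := Vertex.ext (List.cons.inj hv).2.symm
            apply hn
            subst h1 h2
            rw [SimpleGraph.fromEdgeSet_adj]
            refine ⟨rfl, fun e => ?_⟩
            have := congrArg (fun z : Vertex a b => z.word.length) e
            simp [hc] at this
          · exact hv
        · rw [hd]
          exact hv.trans (List.suffix_cons _ _)
    rintro ⟨p⟩
    have := (inv x y p List.suffix_rfl).length_le
    rw [hc] at this
    simp at this
  intro x y h
  rcases h with h | h
  · exact key x y h
  · rw [Sym2.eq_swap]
    exact key y x h

/-- The valence is `a + 1` at the root, `b + 1` on the branch through `[0]`, and `a + 1` at all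
other vertices. -/
theorem ncard_neighborSet_graph (a b : ℕ) (x : Vertex a b) :
    ((graph a b).neighborSet x).ncard =
      if x.word = [] then a + 1 else if x.word.getLast? = some 0 then b + 1 else a + 1 := by
  let child : Fin (numChildren a b x.word) → Vertex a b := fun c => ⟨c.1 :: x.word, c.2, x.isVertex⟩
  have hinj : Function.Injective child := fun c d h =>
    Fin.ext (List.cons.inj (congrArg Vertex.word h)).1
  have hcard : (Set.range child).ncard = numChildren a b x.word := by
    rw [Set.ncard_range_of_injective hinj, Nat.card_fin]
  have hmem : ∀ y : Vertex a b, (∃ c, y.word = c :: x.word) ↔ y ∈ Set.range child := by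
    intro y
    constructor
    · rintro ⟨c, hc⟩
      have hy := y.isVertex
      rw [hc] at hy
      exact ⟨⟨c, hy.1⟩, Vertex.ext hc.symm⟩
    · rintro ⟨c, rfl⟩
      exact ⟨c.1, rfl⟩
  have hadj : ∀ y : Vertex a b, y ∈ (graph a b).neighborSet x ↔
      (∃ c, y.word = c :: x.word) ∨ (∃ c, x.word = c :: y.word) := fun _ => Iff.rfl
  have hx := x.isVertex
  cases hw : x.word with
  | nil =>
    have : (graph a b).neighborSet x = Set.range child := by
      ext y
      rw [← hmem y, hadj y, hw]
      simp
    rw [this, hcard, hw]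
    simp [numChildren]
  | cons d w =>
    rw [hw] at hx
    have : (graph a b).neighborSet x = insert ⟨w, hx.2⟩ (Set.range child) := by
      ext y
      rw [Set.mem_insert_iff, ← hmem y, hadj y, or_comm]
      refine or_congr ⟨?_, ?_⟩ Iff.rfl
      · rintro ⟨c, hc⟩
        rw [hw] at hc
        exact Vertex.ext (List.cons.inj hc).2.symm
      · rintro rfl
        exact ⟨d, hw⟩
    rw [this, Set.ncard_insert_of_notMem _ (Set.finite_range child), hcard, hw]
    · simp only [numChildren, reduceCtorEq, if_false]
      split_ifs <;> rfl
    · rw [← hmem, hw]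
      rintro ⟨c, hc⟩
      have := congrArg List.length hc
      simp at this
      omega

end GluedTree

/-!
A ball `B_r(x)` splits according to the last common ancestor of its points with `x`. If `x` lies
in the part of the tree where every vertex has `q` children, then `|B_r(x)| ≥ q ^ r`, and a large
average over `B_r(x)` forces, with weights `w j` of total mass at most `1`, an ancestor `z` of `x`,
`i` generations up, with `∑ |f| > l * w j * q ^ (i + j)` over the first `j` generations of
descendants of `z`. For fixed `j` and `z` there are at most `q ^ i` such `x`, and the geometric
series is controlled by its last admissible term, so `l` times the number of all `x` is at most
`2 * (w j * q ^ j)⁻¹ ∑ |f|`. If `w j` decays more slowly than `q ^ (-j)`, the sum over `z` and `j`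
gives the weak type bound. The strong bounds follow by interpolation with `L^∞`.

For the uncentred operator let `c < d` be the growth rates of the two branches and choose `n`, `m`
with `c ^ (n + m)` comparable to `d ^ m`. About a vertex of the slow branch at height `n`, the ball
of radius `n + m + 2` contains the generation `m` of the fast branch, in number `d ^ m`, which is a
fixed proportion of the ball. These balls cover `c ^ n * c ^ (n + m + 1)` points of the slow branch,
at each of which the maximal function of the indicator of that generation is bounded below, and
`c ^ n` is arbitrarily large.
-/

section LpBounds

variable {V : Type*} [MeasurableSpace V] {T : (V → ℂ) → V → ℝ≥0∞}

/-- The pointwise estimate that sublinearity, monotonicity in `|f|` and the trivial bound on `L^∞`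
give together; the interpolation of weak type bounds needs nothing else. -/
def IsShiftMonotone (T : (V → ℂ) → V → ℝ≥0∞) : Prop :=
  ∀ (f g : V → ℂ) (t : ℝ≥0∞), (∀ y, ‖f y‖ₑ ≤ ‖g y‖ₑ + t) → ∀ x, T f x ≤ T g x + t

theorem isShiftMonotone_centredMaximal (G : SimpleGraph V) :
    IsShiftMonotone (centredMaximal G) := by
  refine fun f g t h x => iSup_le fun r => ?_
  calc ballAverage G f x r
      ≤ (∫⁻ y in G.distClosedBall x r, (‖g y‖ₑ + t) ∂Measure.count) /
          Measure.count (G.distClosedBall x r) :=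
        ENNReal.div_le_div_right (lintegral_mono h) _
    _ = ballAverage G g x r + t * Measure.count (G.distClosedBall x r) /
          Measure.count (G.distClosedBall x r) := by
        rw [lintegral_add_right _ measurable_const, setLIntegral_const, ENNReal.add_div,
          ballAverage]
    _ ≤ centredMaximal G g x + t :=
        add_le_add (le_iSup (ballAverage G g x) r) (ENNReal.div_le_of_le_mul le_rfl)

theorem IsShiftMonotone.mul_count_two_mul_lt_le (hmono : IsShiftMonotone T) {C : ℝ≥0}
    (hC : ∀ (f : V → ℂ) (l : ℝ≥0), 0 < l →
      l * Measure.count {x | (l : ℝ≥0∞) < T f x} ≤ C * ∑' y, ‖f y‖ₑ)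
    (f : V → ℂ) {l : ℝ≥0} (hl : 0 < l) :
    l * Measure.count {x | 2 * (l : ℝ≥0∞) < T f x} ≤
      C * ∑' y, {y | (l : ℝ≥0∞) < ‖f y‖ₑ}.indicator (‖f ·‖ₑ) y := by
  set g : V → ℂ := {y | (l : ℝ≥0∞) < ‖f y‖ₑ}.indicator f with hg
  have hfg : ∀ y, ‖f y‖ₑ ≤ ‖g y‖ₑ + l := by
    intro y
    by_cases h : (l : ℝ≥0∞) < ‖f y‖ₑ
    · rw [hg, Set.indicator_of_mem (show y ∈ {y | (l : ℝ≥0∞) < ‖f y‖ₑ} from h)]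
      exact le_self_add
    · exact (not_lt.1 h).trans le_add_self
  have hsub : {x | 2 * (l : ℝ≥0∞) < T f x} ⊆ {x | (l : ℝ≥0∞) < T g x} := fun x hx =>
    lt_of_add_lt_add_right (a := (l : ℝ≥0∞)) <| by
      rw [← two_mul]
      exact (show 2 * (l : ℝ≥0∞) < T f x from hx).trans_le (hmono f g l hfg x)
  calc l * Measure.count {x | 2 * (l : ℝ≥0∞) < T f x}
      ≤ l * Measure.count {x | (l : ℝ≥0∞) < T g x} := by gcongr
    _ ≤ C * ∑' y, ‖g y‖ₑ := hC g l hl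
    _ = _ := by simp_rw [hg, enorm_indicator_eq_indicator_enorm]

theorem lintegral_indicator_Iio_rpow {s A : ℝ} (hs : 1 < s) (hA : 0 ≤ A) :
    ∫⁻ t in Set.Ioi 0, (Set.Iio A).indicator (fun t => ENNReal.ofReal (t ^ (s - 2))) t =
      ENNReal.ofReal (s - 1)⁻¹ * ENNReal.ofReal A ^ (s - 1) := by
  have hintegrable : IntegrableOn (fun t : ℝ => t ^ (s - 2)) (Set.Ioc 0 A) := by
    rw [← intervalIntegrable_iff_integrableOn_Ioc_of_le hA]
    exact intervalIntegral.intervalIntegrable_rpow' (by linarith)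
  have hnonneg : ∀ᵐ t ∂volume.restrict (Set.Ioc 0 A), 0 ≤ t ^ (s - 2) := by
    filter_upwards [ae_restrict_mem measurableSet_Ioc] with t ht
    exact Real.rpow_nonneg ht.1.le _
  rw [lintegral_indicator measurableSet_Iio, Measure.restrict_restrict measurableSet_Iio,
    Set.inter_comm, Set.Ioi_inter_Iio, setLIntegral_congr Ioo_ae_eq_Ioc,
    ← ofReal_integral_eq_lintegral_ofReal hintegrable hnonneg,
    ← intervalIntegral.integral_of_le hA, integral_rpow (Or.inl (by linarith)),
    ENNReal.ofReal_rpow_of_nonneg hA (by linarith),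
    ← ENNReal.ofReal_mul (inv_nonneg.2 (by linarith)), show s - 2 + 1 = s - 1 by ring,
    Real.zero_rpow (by linarith), sub_zero, div_eq_inv_mul]

theorem IsShiftMonotone.count_lt_half_mul_rpow_le (hmono : IsShiftMonotone T) {C : ℝ≥0}
    (hC : ∀ (f : V → ℂ) (l : ℝ≥0), 0 < l →
      l * Measure.count {x | (l : ℝ≥0∞) < T f x} ≤ C * ∑' y, ‖f y‖ₑ)
    {f : V → ℂ} (hf : ∀ x, T f x ≠ ∞) (s : ℝ) {t : ℝ} (ht : 0 < t) :
    Measure.count {x | t < (T f x).toReal / 2} * ENNReal.ofReal (t ^ (s - 1)) ≤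
      C * ∑' y, ‖f y‖ₑ *
        (Set.Iio ‖f y‖).indicator (fun t => ENNReal.ofReal (t ^ (s - 2))) t := by
  lift t to ℝ≥0 using ht.le
  have hset : {x | (t : ℝ) < (T f x).toReal / 2} = {x | 2 * (t : ℝ≥0∞) < T f x} := by
    ext x
    rw [Set.mem_ofPred_eq, Set.mem_ofPred_eq, lt_div_iff₀ two_pos, mul_comm,
      ← ENNReal.ofReal_lt_iff_lt_toReal (by positivity) (hf x), ENNReal.ofReal_mul zero_le_two]
    simp
  have hpow : ENNReal.ofReal ((t : ℝ) ^ (s - 1)) = t * ENNReal.ofReal ((t : ℝ) ^ (s - 2)) := by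
    rw [show s - 1 = s - 2 + 1 by ring, Real.rpow_add_one ht.ne', mul_comm,
      ENNReal.ofReal_mul ht.le, ENNReal.ofReal_coe_nnreal]
  have hind : ∀ y, {y | (t : ℝ≥0∞) < ‖f y‖ₑ}.indicator (‖f ·‖ₑ) y *
        ENNReal.ofReal ((t : ℝ) ^ (s - 2)) =
      ‖f y‖ₑ * (Set.Iio ‖f y‖).indicator (fun t => ENNReal.ofReal (t ^ (s - 2))) t := by
    intro y
    have hiff : (t : ℝ≥0∞) < ‖f y‖ₑ ↔ (t : ℝ) < ‖f y‖ := by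
      rw [enorm_eq_nnnorm, ENNReal.coe_lt_coe, ← NNReal.coe_lt_coe, coe_nnnorm]
    by_cases h : (t : ℝ) < ‖f y‖
    · rw [Set.indicator_of_mem (show y ∈ {y | (t : ℝ≥0∞) < ‖f y‖ₑ} from hiff.2 h),
        Set.indicator_of_mem (Set.mem_Iio.2 h)]
    · rw [Set.indicator_of_notMem (show y ∉ {y | (t : ℝ≥0∞) < ‖f y‖ₑ} from mt hiff.1 h),
        Set.indicator_of_notMem (mt Set.mem_Iio.1 h), zero_mul, mul_zero]
  calc Measure.count {x | (t : ℝ) < (T f x).toReal / 2} * ENNReal.ofReal ((t : ℝ) ^ (s - 1))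
      = t * Measure.count {x | 2 * (t : ℝ≥0∞) < T f x} * ENNReal.ofReal ((t : ℝ) ^ (s - 2)) := by
        rw [hset, hpow]
        ring
    _ ≤ C * (∑' y, {y | (t : ℝ≥0∞) < ‖f y‖ₑ}.indicator (‖f ·‖ₑ) y) *
          ENNReal.ofReal ((t : ℝ) ^ (s - 2)) := by
        gcongr ?_ * _
        exact hmono.mul_count_two_mul_lt_le hC f (NNReal.coe_pos.1 ht)
    _ = _ := by
        rw [mul_assoc, ← ENNReal.tsum_mul_right]
        simp_rw [hind]

variable [DiscreteMeasurableSpace V]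

theorem WeakTypeOneOne.exists_mul_count_le (hT : WeakTypeOneOne T) :
    ∃ C : ℝ≥0, ∀ (f : V → ℂ) (l : ℝ≥0), 0 < l →
      l * Measure.count {x | (l : ℝ≥0∞) < T f x} ≤ C * ∑' y, ‖f y‖ₑ := by
  obtain ⟨C, hC⟩ := hT
  refine ⟨C + 1, fun f l hl => ?_⟩
  rw [← lintegral_count, ← eLpNorm_one_eq_lintegral_enorm]
  by_cases hf : eLpNorm f 1 Measure.count = ∞
  · -- The constant is positive, so the right-hand side is infinite.
    simp [hf]
  · have hmem : MemLp f 1 Measure.count :=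
      ⟨Measurable.of_discrete.aestronglyMeasurable, lt_top_iff_ne_top.2 hf⟩
    exact (hC f hmem l hl).trans (by gcongr; simp)

theorem WeakTypeOneOne.apply_zero (hT : WeakTypeOneOne T) (x : V) : T 0 x = 0 := by
  obtain ⟨C, hC⟩ := hT.exists_mul_count_le
  refine nonpos_iff_eq_zero.1 (ENNReal.le_of_forall_pos_le_add fun l hl _ => ?_)
  have hcount : Measure.count {x | (l : ℝ≥0∞) < T 0 x} = 0 := by
    simpa [hl.ne'] using hC 0 l hl
  rw [Measure.count_eq_zero_iff, Set.eq_empty_iff_forall_notMem] at hcount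
  simpa using hcount x

theorem WeakTypeOneOne.apply_le_eLpNorm (hT : WeakTypeOneOne T) (hmono : IsShiftMonotone T)
    {p : ℝ≥0∞} (hp : p ≠ 0) (f : V → ℂ) (x : V) : T f x ≤ eLpNorm f p Measure.count := by
  simpa [hT.apply_zero] using
    hmono f 0 (eLpNorm f p Measure.count) (fun y => by simpa using enorm_le_eLpNorm_count f y hp) x

theorem IsShiftMonotone.lintegral_half_rpow_le [Countable V] (hmono : IsShiftMonotone T) {C : ℝ≥0}
    (hC : ∀ (f : V → ℂ) (l : ℝ≥0), 0 < l →
      l * Measure.count {x | (l : ℝ≥0∞) < T f x} ≤ C * ∑' y, ‖f y‖ₑ)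
    {f : V → ℂ} (hf : ∀ x, T f x ≠ ∞) {s : ℝ} (hs : 1 < s) :
    ∫⁻ x, (T f x / 2) ^ s ∂Measure.count ≤
      ENNReal.ofReal s * (C * ENNReal.ofReal (s - 1)⁻¹) * ∫⁻ y, ‖f y‖ₑ ^ s ∂Measure.count := by
  have hs0 : 0 < s := by linarith
  have hkernel : ∀ y, Measurable fun t : ℝ =>
      (Set.Iio ‖f y‖).indicator (fun t => ENNReal.ofReal (t ^ (s - 2))) t := fun y =>
    Measurable.indicator (by fun_prop) measurableSet_Iio
  have htoReal : ∀ x, (T f x / 2) ^ s = ENNReal.ofReal (((T f x).toReal / 2) ^ s) := fun x => by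
    rw [← ENNReal.ofReal_rpow_of_nonneg (by positivity) hs0.le,
      ENNReal.ofReal_div_of_pos two_pos, ENNReal.ofReal_toReal (hf x), ENNReal.ofReal_ofNat]
  have hpow : ∀ y, ‖f y‖ₑ * ‖f y‖ₑ ^ (s - 1) = ‖f y‖ₑ ^ s := fun y => by
    conv_rhs => rw [← add_sub_cancel 1 s,
      ENNReal.rpow_add_of_nonneg _ _ zero_le_one (by linarith), ENNReal.rpow_one]
  simp_rw [htoReal]
  rw [lintegral_rpow_eq_lintegral_meas_lt_mul Measure.count
    (Filter.Eventually.of_forall fun _ => by positivity)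
    (Measurable.of_discrete.aemeasurable) hs0, mul_assoc]
  gcongr
  calc ∫⁻ t in Set.Ioi (0 : ℝ), Measure.count {x | t < (T f x).toReal / 2} *
        ENNReal.ofReal (t ^ (s - 1))
      ≤ ∫⁻ t in Set.Ioi (0 : ℝ), C * ∑' y, ‖f y‖ₑ *
          (Set.Iio ‖f y‖).indicator (fun t => ENNReal.ofReal (t ^ (s - 2))) t :=
        setLIntegral_mono' measurableSet_Ioi fun t ht =>
          hmono.count_lt_half_mul_rpow_le hC hf s ht
    _ = C * ∑' y, ‖f y‖ₑ * (ENNReal.ofReal (s - 1)⁻¹ * ‖f y‖ₑ ^ (s - 1)) := by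
        rw [lintegral_const_mul _ (.tsum fun y => (hkernel y).const_mul _),
          lintegral_tsum fun y => ((hkernel y).const_mul _).aemeasurable]
        simp_rw [lintegral_const_mul _ (hkernel _),
          lintegral_indicator_Iio_rpow hs (norm_nonneg _), ofReal_norm]
    _ = _ := by
        simp_rw [mul_left_comm _ (ENNReal.ofReal _), hpow, ENNReal.tsum_mul_left,
          lintegral_count, mul_assoc]

/-- The case of the Marcinkiewicz interpolation theorem in which the second endpoint is `L^∞`. -/
theorem WeakTypeOneOne.boundedOnLp [Countable V] (hT : WeakTypeOneOne T)
    (hmono : IsShiftMonotone T) {p : ℝ≥0∞} (hp : 1 < p) : BoundedOnLp T p := by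
  have hp0 : p ≠ 0 := (zero_lt_one.trans hp).ne'
  rcases eq_or_ne p ∞ with rfl | hp'
  · refine ⟨1, fun f _ => ?_⟩
    rw [eLpNorm_exponent_top]
    refine eLpNormEssSup_le_of_ae_enorm_bound (.of_forall fun x => ?_)
    simpa using hT.apply_le_eLpNorm hmono hp0 f x
  obtain ⟨C, hC⟩ := hT.exists_mul_count_le
  set s := p.toReal
  have hs : 1 < s := by simpa using (ENNReal.toReal_lt_toReal ENNReal.one_ne_top hp').2 hp
  have hs0 : 0 ≤ s := by linarith
  set K : ℝ≥0∞ := ENNReal.ofReal s * (C * ENNReal.ofReal (s - 1)⁻¹)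
  have hconst : 2 * K ^ (1 / s) ≠ ∞ :=
    ENNReal.mul_ne_top ENNReal.ofNat_ne_top
      (ENNReal.rpow_ne_top_of_nonneg (by positivity) (by finiteness))
  refine ⟨(2 * K ^ (1 / s)).toNNReal, fun f hf => ?_⟩
  have hfin : ∀ x, T f x ≠ ∞ := fun x =>
    ((hT.apply_le_eLpNorm hmono hp0 f x).trans_lt hf.eLpNorm_lt_top).ne
  have hhalf : ∫⁻ x, T f x ^ s ∂Measure.count = 2 ^ s * ∫⁻ x, (T f x / 2) ^ s ∂Measure.count := by
    rw [← lintegral_const_mul _ .of_discrete]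
    simp_rw [← ENNReal.mul_rpow_of_nonneg _ _ hs0,
      ENNReal.mul_div_cancel two_ne_zero ENNReal.ofNat_ne_top]
  rw [ENNReal.coe_toNNReal hconst, eLpNorm_eq_lintegral_rpow_enorm_toReal hp0 hp',
    eLpNorm_eq_lintegral_rpow_enorm_toReal hp0 hp']
  simp only [enorm_eq_self]
  calc (∫⁻ x, T f x ^ s ∂Measure.count) ^ (1 / s)
      ≤ (2 ^ s * (K * ∫⁻ y, ‖f y‖ₑ ^ s ∂Measure.count)) ^ (1 / s) := by
        rw [hhalf]
        gcongr
        exact hmono.lintegral_half_rpow_le hC hfin hs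
    _ = 2 * K ^ (1 / s) * (∫⁻ y, ‖f y‖ₑ ^ s ∂Measure.count) ^ (1 / s) := by
        rw [ENNReal.mul_rpow_of_nonneg _ _ (by positivity),
          ENNReal.mul_rpow_of_nonneg _ _ (by positivity), ← ENNReal.rpow_mul,
          mul_one_div_cancel (by linarith), ENNReal.rpow_one, mul_assoc]

theorem BoundedOnLp.exists_count_le {p : ℝ≥0∞} (hT : BoundedOnLp T p) (hp : p ≠ 0) (hp' : p ≠ ∞)
    {t : ℝ≥0∞} (ht : t ≠ 0) (ht' : t ≠ ∞) :
    ∃ C ≠ ∞, ∀ A E : Set V, Measure.count E ≠ ∞ → (∀ x ∈ A, t ≤ T (E.indicator 1) x) →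
      Measure.count A ≤ C * Measure.count E := by
  obtain ⟨C, hC⟩ := hT
  have hs : 0 < p.toReal := ENNReal.toReal_pos hp hp'
  refine ⟨t⁻¹ ^ p.toReal * C ^ p.toReal, by finiteness, fun A E hE hA => ?_⟩
  have hnorm : eLpNorm (E.indicator (1 : V → ℂ)) p Measure.count =
      Measure.count E ^ (1 / p.toReal) := by
    simpa using! eLpNorm_indicator_const (c := (1 : ℂ)) (.of_discrete (s := E)) hp hp'
  have hmem : MemLp (E.indicator (1 : V → ℂ)) p Measure.count :=
    ⟨Measurable.of_discrete.aestronglyMeasurable, by rw [hnorm]; finiteness⟩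
  calc Measure.count A
      ≤ Measure.count {x | t ≤ ‖T (E.indicator 1) x‖ₑ} := measure_mono hA
    _ ≤ t⁻¹ ^ p.toReal * eLpNorm (T (E.indicator 1)) p Measure.count ^ p.toReal :=
        meas_ge_le_mul_pow_eLpNorm_enorm _ hp hp' Measurable.of_discrete.aestronglyMeasurable ht
          (fun h => absurd h ht')
    _ ≤ t⁻¹ ^ p.toReal * (C * Measure.count E ^ (1 / p.toReal)) ^ p.toReal := by
        gcongr
        exact (hC _ hmem).trans_eq (by rw [hnorm])
    _ = t⁻¹ ^ p.toReal * C ^ p.toReal * Measure.count E := by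
        rw [ENNReal.mul_rpow_of_nonneg _ _ hs.le, ← ENNReal.rpow_mul,
          one_div_mul_cancel hs.ne', ENNReal.rpow_one, mul_assoc]

end LpBounds

section Genealogy

variable {V : Type*} {G : SimpleGraph V} {P : V → V → Prop}

/-- The relation `P x y`, which says that `x` is the parent of `y`, orients the edges of `G` so that
no vertex has two parents. A rooted tree has this structure; the definition does not exclude
cycles of `P`. -/
structure IsGenealogy (G : SimpleGraph V) (P : V → V → Prop) : Prop where
  adj_iff : ∀ x y, G.Adj x y ↔ P x y ∨ P y x
  leftUnique : Relator.LeftUnique P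

/-- The descendants of `z` by exactly `i` generations. -/
def generation (P : V → V → Prop) (z : V) : ℕ → Set V
  | 0 => {z}
  | i + 1 => {x | ∃ w ∈ generation P z i, P w x}

/-- The descendants of `z` by at most `j` generations. -/
def progeny (P : V → V → Prop) (z : V) (j : ℕ) : Set V := {x | ∃ i ≤ j, x ∈ generation P z i}

theorem mem_generation_one {z x : V} : x ∈ generation P z 1 ↔ P z x := by
  simp [generation]

theorem mem_generation_add {i j : ℕ} {z x : V} :
    x ∈ generation P z (i + j) ↔ ∃ w ∈ generation P z i, x ∈ generation P w j := by
  induction j generalizing x with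
  | zero => simp [generation]
  | succ j ih =>
    constructor
    · rintro ⟨y, hy, hyx⟩
      obtain ⟨w, hw, hwy⟩ := ih.1 hy
      exact ⟨w, hw, y, hwy, hyx⟩
    · rintro ⟨w, hw, y, hwy, hyx⟩
      exact ⟨y, ih.2 ⟨w, hw, hwy⟩, hyx⟩

namespace IsGenealogy

theorem eq_of_mem_generation (hP : IsGenealogy G P) {i : ℕ} {z z' x : V}
    (h : x ∈ generation P z i) (h' : x ∈ generation P z' i) : z = z' := by
  induction i generalizing x with
  | zero => exact h.symm.trans h'
  | succ i ih =>
    obtain ⟨w, hw, hwx⟩ := h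
    obtain ⟨w', hw', hwx'⟩ := h'
    exact ih hw (hP.leftUnique hwx hwx' ▸ hw')

theorem generation_subset_ball (hP : IsGenealogy G P) (z : V) (i : ℕ) :
    generation P z i ⊆ G.distClosedBall z i := by
  have hwalk : ∀ x ∈ generation P z i, ∃ p : G.Walk z x, p.length = i := by
    induction i with
    | zero =>
      rintro x rfl
      exact ⟨.nil, rfl⟩
    | succ i ih =>
      rintro x ⟨w, hw, hwx⟩
      obtain ⟨p, hp⟩ := ih w hw
      exact ⟨p.concat ((hP.adj_iff w x).2 (.inl hwx)), by simp [hp]⟩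
  intro x hx
  obtain ⟨p, rfl⟩ := hwalk x hx
  exact SimpleGraph.dist_le p

theorem exists_common_ancestor_of_walk (hP : IsGenealogy G P) {x y : V} (p : G.Walk x y) :
    ∃ i j z, i + j ≤ p.length ∧ x ∈ generation P z i ∧ y ∈ generation P z j := by
  induction p with
  | @nil x => exact ⟨0, 0, x, le_rfl, rfl, rfl⟩
  | @cons x x' y hadj p ih =>
    obtain ⟨i, j, z, hij, hi, hj⟩ := ih
    rw [SimpleGraph.Walk.length_cons]
    rcases (hP.adj_iff x x').1 hadj with h | h
    · rcases i with _ | i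
      · obtain rfl : x' = z := hi
        exact ⟨0, 1 + j, x, by omega, rfl, mem_generation_add.2 ⟨x', mem_generation_one.2 h, hj⟩⟩
      · obtain ⟨w, hw, hwx'⟩ := hi
        exact ⟨i, j, z, by omega, hP.leftUnique hwx' h ▸ hw, hj⟩
    · exact ⟨i + 1, j, z, by omega, ⟨x', hi, h⟩, hj⟩

theorem exists_common_ancestor (hP : IsGenealogy G P) (hG : G.Connected) {x y : V} {r : ℕ}
    (h : y ∈ G.distClosedBall x r) :
    ∃ i j z, i + j ≤ r ∧ x ∈ generation P z i ∧ y ∈ generation P z j := by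
  obtain ⟨p, hp⟩ := hG.exists_walk_length_eq_dist x y
  obtain ⟨i, j, z, hij, hi, hj⟩ := hP.exists_common_ancestor_of_walk p
  exact ⟨i, j, z, (hij.trans hp.le).trans h, hi, hj⟩

variable {o ρ : V}

theorem inter_ball_subset_progeny {S : Set V} (hP : IsGenealogy G P) (hG : G.Connected)
    (ho : ∀ v, ¬ P v o) (hρ : P o ρ) (hS : ∀ n, Disjoint S (generation P ρ n)) {n : ℕ} {z : V}
    (hz : z ∈ generation P ρ n) (k : ℕ) :
    S ∩ G.distClosedBall z (n + 1 + k) ⊆ progeny P o k := by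
  rintro y ⟨hyS, hy⟩
  obtain ⟨i, j, w, hij, hi, hj⟩ := hP.exists_common_ancestor hG hy
  have hzo : z ∈ generation P o (n + 1) := by
    rw [add_comm]
    exact mem_generation_add.2 ⟨ρ, mem_generation_one.2 hρ, hz⟩
  rcases lt_trichotomy i (n + 1) with hlt | rfl | hgt
  · obtain ⟨m, rfl⟩ := Nat.exists_eq_add_of_le' (Nat.le_of_lt_succ hlt)
    obtain ⟨w', hw', hzw'⟩ := mem_generation_add.1 hz
    obtain rfl := hP.eq_of_mem_generation hzw' hi
    exact absurd (mem_generation_add.2 ⟨w', hw', hj⟩) (Set.disjoint_left.1 (hS _) hyS)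
  · obtain rfl := hP.eq_of_mem_generation hi hzo
    exact ⟨j, by omega, hj⟩
  · obtain ⟨m, rfl⟩ := Nat.exists_eq_add_of_lt hgt
    rw [show n + 1 + m + 1 = m + 1 + (n + 1) by omega] at hi
    obtain ⟨o', ⟨v, -, hv⟩, hzo'⟩ := mem_generation_add.1 hi
    obtain rfl := hP.eq_of_mem_generation hzo' hzo
    exact absurd hv (ho v)

theorem generation_subset_ball_of_siblings {σ : V} (hP : IsGenealogy G P) (hG : G.Connected)
    (hρ : P o ρ) (hσ : P o σ) {n : ℕ} {z : V} (hz : z ∈ generation P ρ n) (m : ℕ) :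
    generation P σ m ⊆ G.distClosedBall z (n + 1 + (m + 1)) := by
  have hdist : ∀ {τ x : V} {i : ℕ}, P o τ → x ∈ generation P τ i → G.dist o x ≤ i + 1 := by
    intro τ x i hτ hx
    refine hP.generation_subset_ball o (i + 1) ?_
    rw [add_comm]
    exact mem_generation_add.2 ⟨τ, mem_generation_one.2 hτ, hx⟩
  intro y hy
  calc G.dist z y ≤ G.dist z o + G.dist o y := hG.dist_triangle
    _ ≤ n + 1 + (m + 1) := by
        rw [SimpleGraph.dist_comm]
        exact add_le_add (hdist hρ hz) (hdist hσ hy)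

variable [MeasurableSpace V]

theorem lintegral_ball_le (hP : IsGenealogy G P) (hG : G.Connected) (F : V → ℝ≥0∞) (x : V)
    (r : ℕ) {g : ℕ → ℝ≥0∞} (hg : ∀ i ≤ r, ∀ z, x ∈ generation P z i →
      ∫⁻ y in progeny P z (r - i), F y ∂Measure.count ≤ g i) :
    ∫⁻ y in G.distClosedBall x r, F y ∂Measure.count ≤ ∑ i ∈ Finset.range (r + 1), g i := by
  let throughAncestor : Fin (r + 1) → Set V := fun i =>
    {y | ∃ z, x ∈ generation P z i ∧ y ∈ progeny P z (r - i)}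
  have hcover : G.distClosedBall x r ⊆ ⋃ i, throughAncestor i := by
    intro y hy
    obtain ⟨i, j, z, hij, hi, hj⟩ := hP.exists_common_ancestor hG hy
    exact Set.mem_iUnion.2 ⟨⟨i, by omega⟩, z, hi, j, by simp only; omega, hj⟩
  have hpiece : ∀ i, ∫⁻ y in throughAncestor i, F y ∂Measure.count ≤ g i := by
    intro i
    by_cases h : ∃ z, x ∈ generation P z i
    · obtain ⟨z, hz⟩ := h
      refine (lintegral_mono_set ?_).trans (hg i (by omega) z hz)
      rintro y ⟨z', hz', hy⟩
      rwa [hP.eq_of_mem_generation hz hz']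
    · have hempty : throughAncestor i = ∅ :=
        Set.eq_empty_of_forall_notMem fun y ⟨z, hz, _⟩ => h ⟨z, hz⟩
      simp [hempty]
  calc _ ≤ ∫⁻ y in ⋃ i, throughAncestor i, F y ∂Measure.count := lintegral_mono_set hcover
    _ ≤ ∑' i, ∫⁻ y in throughAncestor i, F y ∂Measure.count := lintegral_iUnion_le _ _
    _ ≤ ∑' i : Fin (r + 1), g i := ENNReal.tsum_le_tsum hpiece
    _ = ∑ i ∈ Finset.range (r + 1), g i := by rw [tsum_fintype, Fin.sum_univ_eq_sum_range]

variable [DiscreteMeasurableSpace V]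

theorem count_ancestors_le (hP : IsGenealogy G P) (j : ℕ) (y : V) :
    Measure.count {z | y ∈ progeny P z j} ≤ j + 1 := by
  have hone : ∀ i, Measure.count {z | y ∈ generation P z i} ≤ 1 := fun i => by
    rw [Measure.count_apply .of_discrete]
    exact_mod_cast Set.encard_le_one_iff_subsingleton.2 fun z hz z' hz' =>
      hP.eq_of_mem_generation hz hz'
  have hunion : {z | y ∈ progeny P z j} =
      ⋃ i ∈ Finset.range (j + 1), {z | y ∈ generation P z i} := by
    ext z
    simp [progeny]
  calc Measure.count {z | y ∈ progeny P z j}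
      ≤ ∑ i ∈ Finset.range (j + 1), Measure.count {z | y ∈ generation P z i} :=
        hunion ▸ measure_biUnion_finset_le _ _
    _ ≤ ∑ i ∈ Finset.range (j + 1), 1 := Finset.sum_le_sum fun i _ => hone i
    _ = j + 1 := by simp

theorem tsum_lintegral_progeny_le (hP : IsGenealogy G P) (F : V → ℝ≥0∞) (j : ℕ) :
    ∑' z, ∫⁻ y in progeny P z j, F y ∂Measure.count ≤ (j + 1) * ∑' y, F y := by
  classical
  have hsum : ∀ z, ∫⁻ y in progeny P z j, F y ∂Measure.count =
      ∑' y, {z | y ∈ progeny P z j}.indicator (fun _ => F y) z := fun z => by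
    rw [← lintegral_indicator .of_discrete, lintegral_count]
    rfl
  simp_rw [hsum]
  rw [ENNReal.tsum_comm, ← ENNReal.tsum_mul_left]
  gcongr with y
  rw [← lintegral_count, lintegral_indicator_const .of_discrete, mul_comm]
  gcongr
  exact hP.count_ancestors_le j y

variable [Countable V]

theorem count_biUnion_children (hP : IsGenealogy G P) (R S : Set V) :
    Measure.count (⋃ w ∈ S, {x ∈ R | P w x}) = ∑' w : S, Measure.count {x ∈ R | P w x} := by
  rw [measure_biUnion (Set.to_countable _) ?_ fun _ _ => .of_discrete]
  intro w _ w' _ hne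
  exact Set.disjoint_left.2 fun x hx hx' => hne (hP.leftUnique hx.2 hx'.2)

theorem count_inter_generation_le (hP : IsGenealogy G P) {R : Set V} {q : ℝ≥0∞}
    (hR : ∀ v w x, P v w → P w x → x ∈ R → w ∈ R)
    (hq : ∀ w, Measure.count {x ∈ R | P w x} ≤ q) (z : V) (i : ℕ) :
    Measure.count (R ∩ generation P z i) ≤ q ^ i := by
  rcases i with _ | i
  · exact (measure_mono Set.inter_subset_right).trans (by simp [generation])
  induction i with
  | zero => simpa [generation, Set.inter_def] using hq z
  | succ i ih =>
    have hcover : R ∩ generation P z (i + 1 + 1) ⊆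
        ⋃ w ∈ R ∩ generation P z (i + 1), {x ∈ R | P w x} := by
      rintro x ⟨hx, w, hw, hwx⟩
      obtain ⟨v, -, hvw⟩ := id hw
      exact Set.mem_biUnion ⟨hR v w x hvw hwx hx, hw⟩ ⟨hx, hwx⟩
    calc Measure.count (R ∩ generation P z (i + 1 + 1))
        ≤ ∑' w : ↑(R ∩ generation P z (i + 1)), Measure.count {x ∈ R | P w x} :=
          hP.count_biUnion_children R _ ▸ measure_mono hcover
      _ ≤ ∑' _ : ↑(R ∩ generation P z (i + 1)), q := ENNReal.tsum_le_tsum fun w => hq w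
      _ = Measure.count (R ∩ generation P z (i + 1)) * q := by
          rw [ENNReal.tsum_const, Measure.count_apply .of_discrete, Set.encard]
      _ ≤ q ^ (i + 1 + 1) := by
          rw [pow_succ q]
          gcongr

theorem le_count_inter_generation (hP : IsGenealogy G P) {R : Set V} {q : ℝ≥0∞}
    (hq : ∀ w ∈ R, q ≤ Measure.count {x ∈ R | P w x}) {z : V} (hz : z ∈ R) (i : ℕ) :
    q ^ i ≤ Measure.count (R ∩ generation P z i) := by
  induction i with
  | zero => simp [generation, hz]
  | succ i ih =>
    have hsub : ⋃ w ∈ R ∩ generation P z i, {x ∈ R | P w x} ⊆ R ∩ generation P z (i + 1) :=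
      Set.iUnion₂_subset fun w hw x hx => ⟨hx.1, w, hw.2, hx.2⟩
    calc q ^ (i + 1)
        ≤ Measure.count (R ∩ generation P z i) * q := by
          rw [pow_succ]
          gcongr
      _ = ∑' _ : ↑(R ∩ generation P z i), q := by
          rw [ENNReal.tsum_const, Measure.count_apply .of_discrete, Set.encard]
      _ ≤ ∑' w : ↑(R ∩ generation P z i), Measure.count {x ∈ R | P w x} :=
          ENNReal.tsum_le_tsum fun w => hq w w.2.1
      _ ≤ Measure.count (R ∩ generation P z (i + 1)) :=
          hP.count_biUnion_children R _ ▸ measure_mono hsub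

end IsGenealogy

theorem sum_range_pow_le {q : ℕ} (hq : 2 ≤ q) (n : ℕ) :
    ∑ i ∈ Finset.range (n + 1), (q : ℝ≥0∞) ^ i ≤ 2 * (q : ℝ≥0∞) ^ n := by
  rw [Finset.sum_range_succ, two_mul]
  gcongr
  exact_mod_cast (Nat.geomSum_lt hq fun k hk => Finset.mem_range.1 hk).le

theorem tsum_ite_mul_pow_lt_le {q : ℕ} (hq : 2 ≤ q) (s t : ℝ≥0∞) :
    (∑' i : ℕ, if s * (q : ℝ≥0∞) ^ i < t then s * (q : ℝ≥0∞) ^ i else 0) ≤ 2 * t := by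
  refine ENNReal.tsum_le_of_sum_range_le fun n => ?_
  induction n with
  | zero => simp
  | succ n ih =>
    by_cases h : s * (q : ℝ≥0∞) ^ n < t
    · calc ∑ i ∈ Finset.range (n + 1),
            (if s * (q : ℝ≥0∞) ^ i < t then s * (q : ℝ≥0∞) ^ i else 0)
          ≤ ∑ i ∈ Finset.range (n + 1), s * (q : ℝ≥0∞) ^ i :=
            Finset.sum_le_sum fun i _ => by split_ifs <;> simp
        _ ≤ s * (2 * (q : ℝ≥0∞) ^ n) := by
            rw [← Finset.mul_sum]
            gcongr
            exact sum_range_pow_le hq n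
        _ ≤ 2 * t := by
            rw [mul_left_comm]
            gcongr
    · rwa [Finset.sum_range_succ, if_neg h, add_zero]

variable [MeasurableSpace V]

/-- The descendants in `R` of a vertex grow like the powers of `q`: exactly so for a vertex of `R`,
at most so for any other. -/
structure HasGrowth (P : V → V → Prop) (R : Set V) (q : ℕ) : Prop where
  count_le : ∀ z i, Measure.count (R ∩ generation P z i) ≤ (q : ℝ≥0∞) ^ i
  le_count : ∀ z ∈ R, ∀ i, (q : ℝ≥0∞) ^ i ≤ Measure.count (R ∩ generation P z i)

namespace HasGrowth

variable {R : Set V} {q : ℕ}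

theorem count_inter_progeny_le (hR : HasGrowth P R q) (hq : 2 ≤ q) (z : V) (j : ℕ) :
    Measure.count (R ∩ progeny P z j) ≤ 2 * (q : ℝ≥0∞) ^ j := by
  have hunion : R ∩ progeny P z j = ⋃ i ∈ Finset.range (j + 1), R ∩ generation P z i := by
    ext x
    simp [progeny]
  calc Measure.count (R ∩ progeny P z j)
      ≤ ∑ i ∈ Finset.range (j + 1), Measure.count (R ∩ generation P z i) :=
        hunion ▸ measure_biUnion_finset_le _ _
    _ ≤ ∑ i ∈ Finset.range (j + 1), (q : ℝ≥0∞) ^ i :=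
        Finset.sum_le_sum fun i _ => hR.count_le z i
    _ ≤ 2 * (q : ℝ≥0∞) ^ j := sum_range_pow_le hq j

theorem le_count_ball (hR : HasGrowth P R q) (hP : IsGenealogy G P) {x : V} (hx : x ∈ R) (r : ℕ) :
    (q : ℝ≥0∞) ^ r ≤ Measure.count (G.distClosedBall x r) :=
  (hR.le_count x hx r).trans
    (measure_mono (Set.inter_subset_right.trans (hP.generation_subset_ball x r)))

theorem count_inter_ball_le [DiscreteMeasurableSpace V] (hR : HasGrowth P R q)
    (hP : IsGenealogy G P) (hG : G.Connected) (hq : 2 ≤ q) (x : V) (r : ℕ) :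
    Measure.count (R ∩ G.distClosedBall x r) ≤ 4 * (q : ℝ≥0∞) ^ r := by
  have hind : ∀ S : Set V, ∫⁻ y in S, R.indicator 1 y ∂Measure.count = Measure.count (R ∩ S) :=
    fun S => by rw [lintegral_indicator_one .of_discrete, Measure.restrict_apply .of_discrete]
  calc Measure.count (R ∩ G.distClosedBall x r)
      = ∫⁻ y in G.distClosedBall x r, R.indicator 1 y ∂Measure.count := (hind _).symm
    _ ≤ ∑ i ∈ Finset.range (r + 1), 2 * (q : ℝ≥0∞) ^ (r - i) :=
        hP.lintegral_ball_le hG _ x r fun i _ z _ =>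
          hind _ ▸ hR.count_inter_progeny_le hq z (r - i)
    _ = 2 * ∑ i ∈ Finset.range (r + 1), (q : ℝ≥0∞) ^ i := by
        rw [← Finset.mul_sum, ← Finset.sum_range_reflect (fun i => (q : ℝ≥0∞) ^ i)]
        simp
    _ ≤ 2 * (2 * (q : ℝ≥0∞) ^ r) := by
        gcongr
        exact sum_range_pow_le hq r
    _ = 4 * (q : ℝ≥0∞) ^ r := by ring

theorem mul_count_exists_ancestor_le [Countable V] (hR : HasGrowth P R q) (hq : 2 ≤ q)
    (φ : V → ℝ≥0∞) (s : ℝ≥0∞) :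
    s * Measure.count {x ∈ R | ∃ z i, x ∈ generation P z i ∧ s * (q : ℝ≥0∞) ^ i < φ z} ≤
      2 * ∑' z, φ z := by
  have hpiece : ∀ z i,
      s * Measure.count {x ∈ R | x ∈ generation P z i ∧ s * (q : ℝ≥0∞) ^ i < φ z} ≤
        if s * (q : ℝ≥0∞) ^ i < φ z then s * (q : ℝ≥0∞) ^ i else 0 := by
    intro z i
    split_ifs with h
    · gcongr
      have hsub : {x ∈ R | x ∈ generation P z i ∧ s * (q : ℝ≥0∞) ^ i < φ z} ⊆
          R ∩ generation P z i := fun x hx => ⟨hx.1, hx.2.1⟩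
      exact (measure_mono hsub).trans (hR.count_le z i)
    · simp [h]
  have hunion : {x ∈ R | ∃ z i, x ∈ generation P z i ∧ s * (q : ℝ≥0∞) ^ i < φ z} =
      ⋃ (z) (i), {x ∈ R | x ∈ generation P z i ∧ s * (q : ℝ≥0∞) ^ i < φ z} := by
    ext x
    simp only [Set.mem_iUnion, Set.mem_ofPred_eq, exists_and_left]
  calc s * Measure.count {x ∈ R | ∃ z i, x ∈ generation P z i ∧ s * (q : ℝ≥0∞) ^ i < φ z}
      ≤ s * ∑' z, ∑' i,
          Measure.count {x ∈ R | x ∈ generation P z i ∧ s * (q : ℝ≥0∞) ^ i < φ z} := by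
        rw [hunion]
        gcongr
        exact (measure_iUnion_le _).trans (ENNReal.tsum_le_tsum fun z => measure_iUnion_le _)
    _ ≤ ∑' z, ∑' i : ℕ, if s * (q : ℝ≥0∞) ^ i < φ z then s * (q : ℝ≥0∞) ^ i else 0 := by
        simp_rw [← ENNReal.tsum_mul_left]
        exact ENNReal.tsum_le_tsum fun z => ENNReal.tsum_le_tsum fun i => hpiece z i
    _ ≤ ∑' z, 2 * φ z := ENNReal.tsum_le_tsum fun z => tsum_ite_mul_pow_lt_le hq s (φ z)
    _ = 2 * ∑' z, φ z := ENNReal.tsum_mul_left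

end HasGrowth

theorem exists_lt_lintegral_progeny (hP : IsGenealogy G P) (hG : G.Connected) {q : ℕ}
    {w : ℕ → ℝ≥0∞} (hw : ∑' j, w j ≤ 1) {f : V → ℂ} {x : V}
    (hx : ∀ r, (q : ℝ≥0∞) ^ r ≤ Measure.count (G.distClosedBall x r))
    {l : ℝ≥0∞} (h : l < centredMaximal G f x) :
    ∃ j z i, x ∈ generation P z i ∧
      l * ((q : ℝ≥0∞) ^ j * w j) * (q : ℝ≥0∞) ^ i <
        ∫⁻ y in progeny P z j, ‖f y‖ₑ ∂Measure.count := by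
  by_contra! hcon
  obtain ⟨r, hr⟩ := lt_iSup_iff.1 h
  refine hr.not_ge (ENNReal.div_le_of_le_mul ?_)
  calc ∫⁻ y in G.distClosedBall x r, ‖f y‖ₑ ∂Measure.count
      ≤ ∑ i ∈ Finset.range (r + 1), l * ((q : ℝ≥0∞) ^ r * w (r - i)) := by
        refine hP.lintegral_ball_le hG _ x r fun i hi z hz => (hcon (r - i) z i hz).trans_eq ?_
        rw [← Nat.sub_add_cancel hi, pow_add, Nat.sub_add_cancel hi]
        ring
    _ = l * ((q : ℝ≥0∞) ^ r * ∑ j ∈ Finset.range (r + 1), w j) := by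
        rw [← Finset.mul_sum, ← Finset.mul_sum, ← Finset.sum_range_reflect w]
        simp
    _ ≤ l * ((q : ℝ≥0∞) ^ r * 1) := by
        gcongr
        exact (ENNReal.sum_le_tsum _).trans hw
    _ ≤ l * Measure.count (G.distClosedBall x r) := by
        rw [mul_one]
        gcongr
        exact hx r

theorem HasGrowth.mul_count_lt_centredMaximal_le [DiscreteMeasurableSpace V] [Countable V]
    {R : Set V} {q : ℕ} (hR : HasGrowth P R q) (hP : IsGenealogy G P) (hG : G.Connected)
    (hq : 2 ≤ q) {w : ℕ → ℝ≥0∞} (hw : ∑' j, w j ≤ 1) (hw0 : ∀ j, w j ≠ 0) (f : V → ℂ)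
    (l : ℝ≥0∞) :
    l * Measure.count {x ∈ R | l < centredMaximal G f x} ≤
      (∑' j : ℕ, 2 * (j + 1) * ((q : ℝ≥0∞) ^ j * w j)⁻¹) * ∑' y, ‖f y‖ₑ := by
  let v : ℕ → ℝ≥0∞ := fun j => (q : ℝ≥0∞) ^ j * w j
  let φ : ℕ → V → ℝ≥0∞ := fun j z => ∫⁻ y in progeny P z j, ‖f y‖ₑ ∂Measure.count
  let S : ℕ → Set V := fun j =>
    {x ∈ R | ∃ z i, x ∈ generation P z i ∧ l * v j * (q : ℝ≥0∞) ^ i < φ j z}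
  have hv0 : ∀ j, v j ≠ 0 := fun j =>
    mul_ne_zero (pow_ne_zero _ (Nat.cast_ne_zero.2 (by omega))) (hw0 j)
  have hvt : ∀ j, v j ≠ ∞ := fun j => by
    have : w j ≠ ∞ := ((ENNReal.le_tsum j).trans hw).trans_lt ENNReal.one_lt_top |>.ne
    finiteness
  have hcover : {x ∈ R | l < centredMaximal G f x} ⊆ ⋃ j, S j := by
    rintro x ⟨hxR, hx⟩
    obtain ⟨j, hj⟩ := exists_lt_lintegral_progeny hP hG hw (hR.le_count_ball hP hxR) hx
    exact Set.mem_iUnion.2 ⟨j, hxR, hj⟩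
  have hpiece : ∀ j, l * Measure.count (S j) ≤ 2 * (j + 1) * (v j)⁻¹ * ∑' y, ‖f y‖ₑ := by
    intro j
    calc l * Measure.count (S j)
        = (v j)⁻¹ * (l * v j * Measure.count (S j)) := by
          rw [mul_right_comm l, mul_comm _ (v j), ← mul_assoc,
            ENNReal.inv_mul_cancel (hv0 j) (hvt j), one_mul]
      _ ≤ (v j)⁻¹ * (2 * ∑' z, φ j z) := by
          gcongr (v j)⁻¹ * ?_
          exact hR.mul_count_exists_ancestor_le hq (φ j) (l * v j)
      _ ≤ (v j)⁻¹ * (2 * ((j + 1) * ∑' y, ‖f y‖ₑ)) := by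
          gcongr
          exact hP.tsum_lintegral_progeny_le _ j
      _ = 2 * (j + 1) * (v j)⁻¹ * ∑' y, ‖f y‖ₑ := by ring
  calc l * Measure.count {x ∈ R | l < centredMaximal G f x}
      ≤ l * ∑' j, Measure.count (S j) := by
        gcongr
        exact (measure_mono hcover).trans (measure_iUnion_le S)
    _ ≤ ∑' j : ℕ, 2 * (j + 1) * (v j)⁻¹ * ∑' y, ‖f y‖ₑ := by
        rw [← ENNReal.tsum_mul_left]
        exact ENNReal.tsum_le_tsum hpiece
    _ = (∑' j : ℕ, 2 * (j + 1) * (v j)⁻¹) * ∑' y, ‖f y‖ₑ := ENNReal.tsum_mul_right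

theorem exists_weight {q : ℕ} (hq : 2 ≤ q) : ∃ w : ℕ → ℝ≥0∞, ∑' j, w j ≤ 1 ∧ (∀ j, w j ≠ 0) ∧
    ∑' j : ℕ, 2 * (j + 1) * ((q : ℝ≥0∞) ^ j * w j)⁻¹ ≠ ∞ := by
  have hsum : HasSum (fun j : ℕ => (4⁻¹ * (3 / 4) ^ j : ℝ)) 1 := by
    convert! (hasSum_geometric_of_lt_one (r := 3 / 4) (by norm_num) (by norm_num)).mul_left
      (4⁻¹ : ℝ) using 1
    norm_num
  have hdom : Summable fun j : ℕ => (8 : ℝ) * ((j : ℝ) ^ 1 * (2 / 3) ^ j + (2 / 3) ^ j) :=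
    ((summable_pow_mul_geometric_of_norm_lt_one 1 (by norm_num)).add
      (summable_geometric_of_lt_one (by norm_num) (by norm_num))).mul_left 8
  have hle : ∀ j : ℕ, 2 * (j + 1) * ((q : ℝ≥0∞) ^ j * ENNReal.ofReal (4⁻¹ * (3 / 4) ^ j))⁻¹ ≤
      ENNReal.ofReal (8 * ((j : ℝ) ^ 1 * (2 / 3) ^ j + (2 / 3) ^ j)) := by
    intro j
    have hq' : (2 : ℝ≥0∞) ≤ q := by exact_mod_cast hq
    calc 2 * (j + 1) * ((q : ℝ≥0∞) ^ j * ENNReal.ofReal (4⁻¹ * (3 / 4) ^ j))⁻¹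
        ≤ 2 * (j + 1) * (2 ^ j * ENNReal.ofReal (4⁻¹ * (3 / 4) ^ j))⁻¹ := by gcongr
      _ = ENNReal.ofReal (2 * (j + 1) * (2 ^ j * (4⁻¹ * (3 / 4) ^ j))⁻¹) := by
          have hpos : (0 : ℝ) < 4⁻¹ * (3 / 4) ^ j := by positivity
          generalize (4⁻¹ * (3 / 4) ^ j : ℝ) = c at hpos ⊢
          rw [ENNReal.ofReal_mul (by positivity), ENNReal.ofReal_inv_of_pos (by positivity),
            ENNReal.ofReal_mul (p := 2 ^ j) (by positivity), ENNReal.ofReal_pow zero_le_two,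
            ENNReal.ofReal_mul zero_le_two, ENNReal.ofReal_add (by positivity) zero_le_one]
          simp
      _ = ENNReal.ofReal (8 * ((j : ℝ) ^ 1 * (2 / 3) ^ j + (2 / 3) ^ j)) := by
          congr 1
          rw [mul_left_comm, ← mul_pow, mul_inv, ← inv_pow]
          norm_num
          ring
  refine ⟨fun j => ENNReal.ofReal (4⁻¹ * (3 / 4) ^ j), ?_, fun j => ?_, ?_⟩
  · rw [← ENNReal.ofReal_tsum_of_nonneg (fun _ => by positivity) hsum.summable, hsum.tsum_eq,
      ENNReal.ofReal_one]
  · exact (ENNReal.ofReal_pos.2 (by positivity)).ne'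
  · exact ne_top_of_le_ne_top hdom.tsum_ofReal_ne_top (ENNReal.tsum_le_tsum hle)

theorem HasGrowth.exists_mul_count_lt_centredMaximal_le [DiscreteMeasurableSpace V] [Countable V]
    {R : Set V} {q : ℕ} (hR : HasGrowth P R q) (hP : IsGenealogy G P) (hG : G.Connected)
    (hq : 2 ≤ q) : ∃ C : ℝ≥0, ∀ (f : V → ℂ) (l : ℝ≥0∞),
      l * Measure.count {x ∈ R | l < centredMaximal G f x} ≤ C * eLpNorm f 1 Measure.count := by
  obtain ⟨w, hw, hw0, hfin⟩ := exists_weight hq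
  refine ⟨(∑' j : ℕ, 2 * (j + 1) * ((q : ℝ≥0∞) ^ j * w j)⁻¹).toNNReal, fun f l => ?_⟩
  rw [ENNReal.coe_toNNReal hfin, eLpNorm_one_eq_lintegral_enorm, lintegral_count]
  exact hR.mul_count_lt_centredMaximal_le hP hG hq hw hw0 f l

theorem weakTypeOneOne_centredMaximal [DiscreteMeasurableSpace V] [Countable V]
    (hP : IsGenealogy G P) (hG : G.Connected) {R S : Set V} (hRS : R ∪ S = Set.univ) {q r : ℕ}
    (hR : HasGrowth P R q) (hq : 2 ≤ q) (hS : HasGrowth P S r) (hr : 2 ≤ r) :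
    WeakTypeOneOne (centredMaximal G) := by
  obtain ⟨C, hC⟩ := hR.exists_mul_count_lt_centredMaximal_le hP hG hq
  obtain ⟨D, hD⟩ := hS.exists_mul_count_lt_centredMaximal_le hP hG hr
  refine ⟨C + D, fun f _ l _ => ?_⟩
  have hunion : {x | (l : ℝ≥0∞) < centredMaximal G f x} =
      {x ∈ R | (l : ℝ≥0∞) < centredMaximal G f x} ∪
        {x ∈ S | (l : ℝ≥0∞) < centredMaximal G f x} := by
    rw [← Set.ofPred_or]
    ext x
    simp [← or_and_right, show x ∈ R ∨ x ∈ S from hRS.ge (Set.mem_univ x)]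
  calc l * Measure.count {x | (l : ℝ≥0∞) < centredMaximal G f x}
      ≤ l * (Measure.count {x ∈ R | (l : ℝ≥0∞) < centredMaximal G f x} +
          Measure.count {x ∈ S | (l : ℝ≥0∞) < centredMaximal G f x}) := by
        rw [hunion]
        gcongr
        exact measure_union_le _ _
    _ ≤ (C + D : ℝ≥0) * eLpNorm f 1 Measure.count := by
        rw [mul_add, ENNReal.coe_add, add_mul]
        exact add_le_add (hC f l) (hD f l)

theorem inv_le_uncentredMaximal_indicator [DiscreteMeasurableSpace V] {E : Set V} {x z : V} {r : ℕ}
    (hE : E ⊆ G.distClosedBall z r) (hx : x ∈ G.distClosedBall z r) (hE0 : Measure.count E ≠ 0)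
    (hE' : Measure.count E ≠ ∞) {K : ℝ≥0∞}
    (hK : Measure.count (G.distClosedBall z r) ≤ K * Measure.count E) :
    K⁻¹ ≤ uncentredMaximal G (E.indicator 1) x := by
  have hintegral : ∫⁻ y in G.distClosedBall z r, ‖E.indicator (1 : V → ℂ) y‖ₑ ∂Measure.count =
      Measure.count E := by
    simp_rw [enorm_indicator_eq_indicator_enorm, Pi.one_apply, enorm_one]
    rw [lintegral_indicator_const .of_discrete, Measure.restrict_apply .of_discrete,
      Set.inter_eq_left.2 hE, one_mul]
  calc K⁻¹ = Measure.count E / (K * Measure.count E) := by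
        rw [div_eq_mul_inv, ENNReal.mul_inv (.inr hE') (.inr hE0), mul_left_comm,
          ENNReal.mul_inv_cancel hE0 hE', mul_one]
    _ ≤ Measure.count E / Measure.count (G.distClosedBall z r) := by gcongr
    _ = ballAverage G (E.indicator 1) z r := by rw [ballAverage, hintegral]
    _ ≤ uncentredMaximal G (E.indicator 1) x :=
        le_iSup_of_le z (le_iSup₂_of_le r hx le_rfl)

theorem exists_pow_add_le_pow {c d : ℕ} (hc : 2 ≤ c) (hcd : c < d) (N : ℕ) :
    ∃ n m, N ≤ n ∧ c ^ (n + m) ≤ d ^ m ∧ d ^ m ≤ c ^ (n + (m + 1)) := by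
  obtain ⟨m, hm⟩ : ∃ m, c ^ (N + m) ≤ d ^ m := by
    have hratio : (1 : ℝ) < d / c := by
      rw [one_lt_div (by positivity)]
      exact_mod_cast hcd
    obtain ⟨m, hm⟩ := pow_unbounded_of_one_lt ((c : ℝ) ^ N) hratio
    refine ⟨m, ?_⟩
    rw [div_pow, lt_div_iff₀ (by positivity), ← pow_add] at hm
    exact_mod_cast hm.le
  have hlog : N + m ≤ Nat.log c (d ^ m) := Nat.le_log_of_pow_le (by omega) hm
  refine ⟨Nat.log c (d ^ m) - m, m, by omega, ?_, ?_⟩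
  · rw [Nat.sub_add_cancel (by omega)]
    exact Nat.pow_log_le_self c (pow_ne_zero _ (by omega))
  · rw [show Nat.log c (d ^ m) - m + (m + 1) = (Nat.log c (d ^ m)).succ by omega]
    exact (Nat.lt_pow_succ_log_self (by omega) _).le

namespace IsGenealogy

variable {o ρ σ : V} {R S : Set V} {c d : ℕ}

variable [DiscreteMeasurableSpace V]

theorem count_ball_le (hP : IsGenealogy G P) (hG : G.Connected) (ho : ∀ v, ¬ P v o) (hρ : P o ρ)
    (hRS : R ∪ S = Set.univ) (hR : HasGrowth P R c) (hS : HasGrowth P S d) (hc : 2 ≤ c)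
    (hd : 2 ≤ d) (hSρ : ∀ n, Disjoint S (generation P ρ n)) {n m : ℕ}
    (hnm : c ^ (n + m) ≤ d ^ m) {z : V} (hz : z ∈ generation P ρ n) :
    Measure.count (G.distClosedBall z (n + 1 + (m + 1))) ≤
      (4 * c ^ 2 + 2 * d) * (d : ℝ≥0∞) ^ m := by
  have hpow : (c : ℝ≥0∞) ^ (n + m) ≤ (d : ℝ≥0∞) ^ m := by exact_mod_cast hnm
  calc Measure.count (G.distClosedBall z (n + 1 + (m + 1)))
      ≤ Measure.count (R ∩ G.distClosedBall z (n + 1 + (m + 1))) +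
          Measure.count (S ∩ G.distClosedBall z (n + 1 + (m + 1))) := by
        conv_lhs =>
          rw [← Set.univ_inter (G.distClosedBall z _), ← hRS, Set.union_inter_distrib_right]
        exact measure_union_le _ _
    _ ≤ 4 * (c : ℝ≥0∞) ^ (n + 1 + (m + 1)) + 2 * (d : ℝ≥0∞) ^ (m + 1) := by
        gcongr
        · exact hR.count_inter_ball_le hP hG hc z _
        · exact (measure_mono (Set.subset_inter Set.inter_subset_left
            (hP.inter_ball_subset_progeny hG ho hρ hSρ hz (m + 1)))).trans
            (hS.count_inter_progeny_le hd o (m + 1))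
    _ = 4 * c ^ 2 * (c : ℝ≥0∞) ^ (n + m) + 2 * d * (d : ℝ≥0∞) ^ m := by ring
    _ ≤ (4 * c ^ 2 + 2 * d) * (d : ℝ≥0∞) ^ m := by
        rw [add_mul]
        gcongr

theorem inv_le_uncentredMaximal_generation (hP : IsGenealogy G P) (hG : G.Connected)
    (ho : ∀ v, ¬ P v o) (hρ : P o ρ) (hσ : P o σ) (hRS : R ∪ S = Set.univ)
    (hR : HasGrowth P R c) (hS : HasGrowth P S d) (hc : 2 ≤ c) (hd : 2 ≤ d) (hσS : σ ∈ S)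
    (hSρ : ∀ n, Disjoint S (generation P ρ n)) {n m : ℕ} (hnm : c ^ (n + m) ≤ d ^ m) {x : V}
    (hx : x ∈ generation P ρ (n + (n + (m + 1)))) :
    (4 * c ^ 2 + 2 * d : ℝ≥0∞)⁻¹ ≤
      uncentredMaximal G ((S ∩ generation P σ m).indicator 1) x := by
  obtain ⟨z, hz, hzx⟩ := mem_generation_add.1 hx
  have hcount : Measure.count (S ∩ generation P σ m) = (d : ℝ≥0∞) ^ m :=
    le_antisymm (hS.count_le σ m) (hS.le_count σ hσS m)
  have hxz : G.dist z x ≤ n + (m + 1) := hP.generation_subset_ball z _ hzx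
  refine inv_le_uncentredMaximal_indicator (z := z) (r := n + 1 + (m + 1)) ?_ ?_ ?_ ?_ ?_
  · exact Set.inter_subset_right.trans (hP.generation_subset_ball_of_siblings hG hρ hσ hz m)
  · exact hxz.trans (by omega)
  · exact hcount ▸ pow_ne_zero _ (Nat.cast_ne_zero.2 (by omega))
  · exact hcount ▸ ENNReal.pow_ne_top (ENNReal.natCast_ne_top d)
  · exact hcount ▸ hP.count_ball_le hG ho hρ hRS hR hS hc hd hSρ hnm hz

theorem not_boundedOnLp_uncentredMaximal (hP : IsGenealogy G P) (hG : G.Connected)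
    (ho : ∀ v, ¬ P v o) (hρ : P o ρ) (hσ : P o σ) (hRS : R ∪ S = Set.univ)
    (hR : HasGrowth P R c) (hS : HasGrowth P S d) (hc : 2 ≤ c) (hcd : c < d) (hρR : ρ ∈ R)
    (hσS : σ ∈ S) (hSρ : ∀ n, Disjoint S (generation P ρ n)) {p : ℝ≥0∞} (hp : p ≠ 0)
    (hp' : p ≠ ∞) : ¬ BoundedOnLp (uncentredMaximal G) p := by
  intro hT
  obtain ⟨C, hCt, hC⟩ := hT.exists_count_le (t := (4 * c ^ 2 + 2 * d : ℝ≥0∞)⁻¹) hp hp'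
    (ENNReal.inv_ne_zero.2 (by finiteness)) (by simp; omega)
  have hpow_le : ∀ N : ℕ, (c : ℝ≥0∞) ^ N ≤ C := by
    intro N
    obtain ⟨n, m, hNn, hnm, hnm'⟩ := exists_pow_add_le_pow hc hcd N
    have hd0 : (d : ℝ≥0∞) ^ m ≠ 0 := pow_ne_zero _ (Nat.cast_ne_zero.2 (by omega))
    have hdt : (d : ℝ≥0∞) ^ m ≠ ∞ := ENNReal.pow_ne_top (ENNReal.natCast_ne_top d)
    have hE : Measure.count (S ∩ generation P σ m) ≤ (d : ℝ≥0∞) ^ m := hS.count_le σ m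
    rw [← ENNReal.mul_le_mul_iff_left hd0 hdt]
    calc (c : ℝ≥0∞) ^ N * (d : ℝ≥0∞) ^ m
        ≤ (c : ℝ≥0∞) ^ n * (c : ℝ≥0∞) ^ (n + (m + 1)) := by
          refine mul_le_mul' (pow_le_pow_right₀ ?_ hNn) (by exact_mod_cast hnm')
          exact_mod_cast (by omega : 1 ≤ c)
      _ ≤ Measure.count (R ∩ generation P ρ (n + (n + (m + 1)))) :=
          pow_add (c : ℝ≥0∞) n _ ▸ hR.le_count ρ hρR _
      _ ≤ C * Measure.count (S ∩ generation P σ m) :=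
          hC _ _ (ne_top_of_le_ne_top hdt hE) fun x hx =>
            hP.inv_le_uncentredMaximal_generation hG ho hρ hσ hRS hR hS hc (by omega) hσS hSρ hnm
              hx.2
      _ ≤ C * (d : ℝ≥0∞) ^ m := by gcongr
  obtain ⟨N, hN⟩ := ENNReal.exists_nat_gt hCt
  have hlt : (N : ℝ≥0∞) < (c : ℝ≥0∞) ^ N := by exact_mod_cast Nat.lt_pow_self (by omega : 1 < c)
  exact (hN.trans hlt).not_ge (hpow_le N)

end IsGenealogy
end Genealogy

namespace GluedTree

variable {a b : ℕ}

instance : Countable (Vertex a b) :=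
  Function.Injective.countable (f := Vertex.word) fun _ _ h => Vertex.ext h

/-- The parent of a vertex is its neighbour on the geodesic to the root. -/
def IsParent (x y : Vertex a b) : Prop := ∃ c, y.word = c :: x.word

theorem isGenealogy_graph : IsGenealogy (graph a b) IsParent where
  adj_iff _ _ := Iff.rfl
  leftUnique := fun _ _ _ ⟨_, h⟩ ⟨_, h'⟩ => Vertex.ext (List.cons.inj (h.symm.trans h')).2

theorem IsParent.ne_nil {v w : Vertex a b} (h : IsParent v w) : w.word ≠ [] := by
  obtain ⟨c, hc⟩ := h
  simp [hc]

theorem IsParent.getLast?_eq {w x : Vertex a b} (h : IsParent w x) (hw : w.word ≠ []) :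
    x.word.getLast? = w.word.getLast? := by
  obtain ⟨c, hc⟩ := h
  rw [hc, List.getLast?_cons_of_ne_nil hw]

theorem getLast?_eq_of_mem_generation {z x : Vertex a b} {n : ℕ} (hz : z.word ≠ [])
    (hx : x ∈ generation IsParent z n) : x.word.getLast? = z.word.getLast? := by
  induction n generalizing x with
  | zero => rw [show x = z from hx]
  | succ n ih =>
    obtain ⟨w, hw, hwx⟩ := hx
    have hw' : w.word ≠ [] := fun h =>
      hz (List.getLast?_eq_none_iff.1 ((ih hw).symm.trans (List.getLast?_eq_none_iff.2 h)))
    rw [hwx.getLast?_eq hw', ih hw]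

/-- The vertices whose geodesic from the root does not go through `[0]`. -/
def thinPart (a b : ℕ) : Set (Vertex a b) := {x | x.word.getLast? ≠ some 0}

/-- The vertices whose geodesic from the root goes through `[0]`. -/
def thickPart (a b : ℕ) : Set (Vertex a b) := {x | x.word.getLast? = some 0}

theorem count_children (Q : List ℕ → Prop) [DecidablePred Q] (w : Vertex a b) :
    Measure.count {x : Vertex a b | Q x.word ∧ IsParent w x} =
      {c ∈ Finset.range (numChildren a b w.word) | Q (c :: w.word)}.card := by
  set S := {c ∈ Finset.range (numChildren a b w.word) | Q (c :: w.word)}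
  have hS : ∀ {c}, c ∈ S ↔ c < numChildren a b w.word ∧ Q (c :: w.word) := by simp [S]
  let child : S → Vertex a b := fun c => ⟨c.1 :: w.word, (hS.1 c.2).1, w.isVertex⟩
  have hinj : Function.Injective child := fun c d h =>
    Subtype.ext (List.cons.inj (congrArg Vertex.word h)).1
  have hrange : {x : Vertex a b | Q x.word ∧ IsParent w x} = Set.range child := by
    ext x
    constructor
    · rintro ⟨hQ, c, hc⟩
      have hx := x.isVertex
      rw [hc] at hx hQ
      exact ⟨⟨c, hS.2 ⟨hx.1, hQ⟩⟩, Vertex.ext hc.symm⟩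
    · rintro ⟨c, rfl⟩
      exact ⟨(hS.1 c.2).2, c, rfl⟩
  rw [hrange, Measure.count_apply .of_discrete, ← Set.image_univ, hinj.encard_image]
  simp

theorem count_children_thinPart (w : Vertex a b) :
    Measure.count {x ∈ thinPart a b | IsParent w x} =
      ((if w.word.getLast? = some 0 then 0 else a : ℕ) : ℝ≥0∞) := by
  refine (count_children (fun u => u.getLast? ≠ some 0) w).trans (congrArg _ ?_)
  by_cases hw : w.word = []
  · simp [hw, numChildren, Finset.filter_ne']
  · simp only [List.getLast?_cons_of_ne_nil hw, Finset.filter_const, numChildren, hw, if_false]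
    split_ifs <;> simp_all

theorem count_children_thickPart (w : Vertex a b) :
    Measure.count {x ∈ thickPart a b | IsParent w x} =
      ((if w.word = [] then 1 else if w.word.getLast? = some 0 then b else 0 : ℕ) : ℝ≥0∞) := by
  refine (count_children (fun u => u.getLast? = some 0) w).trans (congrArg _ ?_)
  by_cases hw : w.word = []
  · simp [hw, numChildren, Finset.filter_eq']
  · simp only [List.getLast?_cons_of_ne_nil hw, Finset.filter_const, numChildren, hw, if_false]
    split_ifs <;> simp

theorem hasGrowth_thinPart : HasGrowth IsParent (thinPart a b) a where
  count_le z i := by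
    refine isGenealogy_graph.count_inter_generation_le (fun v w x hvw hwx hx => ?_) (fun w => ?_)
      z i
    · exact (hwx.getLast?_eq hvw.ne_nil).symm.trans_ne hx
    · rw [count_children_thinPart]
      split_ifs <;> simp
  le_count z hz i := by
    refine isGenealogy_graph.le_count_inter_generation (fun w hw => ?_) hz i
    rw [count_children_thinPart, if_neg hw]

theorem hasGrowth_thickPart (hb : 1 ≤ b) : HasGrowth IsParent (thickPart a b) b where
  count_le z i := by
    refine isGenealogy_graph.count_inter_generation_le (fun v w x hvw hwx hx => ?_) (fun w => ?_)
      z i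
    · exact (hwx.getLast?_eq hvw.ne_nil).symm.trans hx
    · rw [count_children_thickPart, Nat.cast_le]
      split_ifs <;> omega
  le_count z hz i := by
    refine isGenealogy_graph.le_count_inter_generation (fun w hw => ?_) hz i
    have hlast : w.word.getLast? = some 0 := hw
    have hw' : w.word ≠ [] := by
      intro h
      simp [h] at hlast
    rw [count_children_thickPart, if_neg hw', if_pos hlast]

theorem thinPart_union_thickPart : thinPart a b ∪ thickPart a b = Set.univ :=
  Set.compl_union_self _

theorem disjoint_thickPart_generation {z : Vertex a b} (hz : z ∈ thinPart a b) (hz' : z.word ≠ [])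
    (n : ℕ) : Disjoint (thickPart a b) (generation IsParent z n) :=
  Set.disjoint_left.2 fun _ hx hxz => hz ((getLast?_eq_of_mem_generation hz' hxz).symm.trans hx)

theorem disjoint_thinPart_generation {z : Vertex a b} (hz : z ∈ thickPart a b) (hz' : z.word ≠ [])
    (n : ℕ) : Disjoint (thinPart a b) (generation IsParent z n) :=
  Set.disjoint_left.2 fun _ hx hxz => hx ((getLast?_eq_of_mem_generation hz' hxz).trans hz)

theorem weakTypeOneOne_centredMaximal_graph (ha : 2 ≤ a) (hb : 2 ≤ b) :
    WeakTypeOneOne (centredMaximal (graph a b)) :=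
  weakTypeOneOne_centredMaximal isGenealogy_graph (connected_graph a b) thinPart_union_thickPart
    hasGrowth_thinPart ha (hasGrowth_thickPart (by omega)) hb

theorem not_boundedOnLp_uncentredMaximal_graph (ha : 2 ≤ a) (hb : 2 ≤ b) (hab : a ≠ b)
    {p : ℝ≥0∞} (hp : p ≠ 0) (hp' : p ≠ ∞) :
    ¬ BoundedOnLp (uncentredMaximal (graph a b)) p := by
  let root : Vertex a b := ⟨[], trivial⟩
  let thick : Vertex a b := ⟨[0], by simp [numChildren], trivial⟩
  let thin : Vertex a b := ⟨[1], by simp [numChildren]; omega, trivial⟩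
  have hroot : ∀ v, ¬ IsParent v root := fun v h => h.ne_nil rfl
  have hthick : IsParent root thick := ⟨0, rfl⟩
  have hthin : IsParent root thin := ⟨1, rfl⟩
  have hmem_thick : thick ∈ thickPart a b := rfl
  have hmem_thin : thin ∈ thinPart a b := by simp [thinPart, thin]
  have hgrowth : HasGrowth IsParent (thickPart a b) b := hasGrowth_thickPart (by omega)
  rcases hab.lt_or_gt with hlt | hlt
  · exact isGenealogy_graph.not_boundedOnLp_uncentredMaximal (connected_graph a b) hroot hthin
      hthick thinPart_union_thickPart hasGrowth_thinPart hgrowth ha hlt hmem_thin hmem_thick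
      (disjoint_thickPart_generation hmem_thin hthin.ne_nil) hp hp'
  · exact isGenealogy_graph.not_boundedOnLp_uncentredMaximal (connected_graph a b) hroot hthick
      hthin (Set.union_comm _ _ ▸ thinPart_union_thickPart) hgrowth hasGrowth_thinPart hb hlt
      hmem_thick hmem_thin (disjoint_thinPart_generation hmem_thick hthick.ne_nil) hp hp'

end GluedTree

theorem theorem4p1_general (a b : ℕ) (ha : 2 ≤ a) (hb : 2 ≤ b) :
    (a ≠ b → ∀ p : ℝ≥0∞, p ≠ 0 → p ≠ ∞ →
      ¬ BoundedOnLp (uncentredMaximal (GluedTree.graph a b)) p) ∧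
    (∀ p : ℝ≥0∞, 1 < p → BoundedOnLp (centredMaximal (GluedTree.graph a b)) p) ∧
    WeakTypeOneOne (centredMaximal (GluedTree.graph a b)) := by
  have hweak := GluedTree.weakTypeOneOne_centredMaximal_graph ha hb
  exact ⟨fun hab _ hp hp' => GluedTree.not_boundedOnLp_uncentredMaximal_graph ha hb hab hp hp',
    fun _ hp => hweak.boundedOnLp (isShiftMonotone_centredMaximal _) hp, hweak⟩

theorem theorem4p1 (a b : ℕ) (ha : 2 ≤ a) (hab : a < b) :
    (∀ p : ℝ≥0∞, 1 ≤ p → p ≠ ∞ →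
      ¬ BoundedOnLp (uncentredMaximal (GluedTree.graph a b)) p) ∧
    (∀ p : ℝ≥0∞, 1 < p → p ≠ ∞ →
      BoundedOnLp (centredMaximal (GluedTree.graph a b)) p) ∧
    WeakTypeOneOne (centredMaximal (GluedTree.graph a b)) := by
  obtain ⟨hN, hM, hweak⟩ := theorem4p1_general a b ha (ha.trans hab.le)
  exact ⟨fun p hp => hN hab.ne p (zero_lt_one.trans_le hp).ne', fun p hp _ => hM p hp, hweak⟩
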